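/- Let $X$ be a compact (connected) Riemann surface and let $f : X \to X$ be a holomorphic map of topological degree $\lambda \ge 2$, that is, every point of $X$ outside some finite set has exactly $\lambda$ preimages under $f$. Fix a smooth positive volume form $\omega$ on $X$ and write $\mathrm{Vol}(A) = \int_A \omega$. Then there is a constant $C > 0$ (depending on $X$, $f$ and $\omega$) such that for every integer $j \ge 0$ and every Borel set $\Omega \subset X$ with $\mathrm{Vol}(\Omega) > 0$, $$\mathrm{Vol}(f^j(\Omega)) \;\ge\; \exp\left(-\frac{C}{\mathrm{Vol}(\Omega)}\,\lambda^j\right),$$ where $f^j$ denotes the $j$-th iterate of $f$. -/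

import Mathlib

open scoped Manifold ContDiff
open MeasureTheory

/-- The map `f` has topological degree `d`: every point outside some finite set
has exactly `d` preimages. -/
def HasTopologicalDegree {X : Type*} (f : X → X) (d : ℕ) : Prop :=
  ∃ S : Set X, S.Finite ∧ ∀ y ∉ S, (f ⁻¹' {y}).encard = d

/-- The Borel measure `vol` on the Riemann surface `X` is the measure of a smooth (positive) volume
form: in each holomorphic chart `e` with coordinate `z = x + i y` the form is `ρ dx ∧ dy` for a
smooth function `ρ > 0`, and `vol A` is its integral over `A`. -/
def IsSmoothVolume {X : Type*} [TopologicalSpace X] [ChartedSpace ℂ X] [MeasurableSpace X]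
    (vol : Measure X) : Prop :=
  ∀ e ∈ atlas ℂ X, ∃ ρ : ℂ → ℝ, ContDiffOn ℝ ∞ ρ e.target ∧ (∀ z ∈ e.target, 0 < ρ z) ∧
    ∀ A : Set X, MeasurableSet A → A ⊆ e.source →
      vol A = ∫⁻ z in e '' A, ENNReal.ofReal (ρ z)

/-!
Each application of `f` multiplies `log (1 / vol Ω)` by at most `lam`, up to an additive constant.
This is the one-step estimate `c * vol (A) ^ lam ≤ vol (f '' A)`
(`exists_mul_pow_le_real_image`), in which `A` need not be measurable. It gives by induction
`(c * vol Ω) ^ (lam ^ j) ≤ c * vol (f^[j] '' Ω)`, and `exp (-1 / x) ≤ x` for `x = c * vol Ω` then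
yields the theorem with `C = 1 / c`.

The one-step estimate is equivalent to the bound `vol (f ⁻¹' B) ≤ K * vol (B) ^ (1 / lam)`, which
by compactness is local on the source. It is stated in the root-free form "if `vol B ≤ t ^ lam`
then `vol (f ⁻¹' B) ≤ K * t`".

Near a point, in holomorphic coordinates, `f = f x + φ ^ m` with `φ` a local biholomorphism
(`AnalyticAt.exists_eq_add_pow`). The map `φ` distorts areas by bounded factors only, so it is
enough to bound the area of `{z | z ^ m ∈ B}` (`exists_volume_preimage_pow_le`). That set is a union
of `m` rotated copies of the image `S` of `B` under the principal branch of the `m`-th root. The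
part of `S` in the disc of radius `√t` has area at most `π * t`; on the rest, `z ↦ z ^ m` is
injective and expands areas by a factor of at least `t ^ (m - 1)`.

It remains to see that `m ≤ lam`: a point close to `f x`, but different from it, has at least `m`
preimages near `x` (`AnalyticAt.exists_order`), and all but finitely many points have exactly `lam`.
That `f` is nowhere locally constant follows from the identity principle and connectedness
(`HasTopologicalDegree.not_eventually_eq`).
-/

open Filter Topology Set

/-! ### Areas under holomorphic maps of the plane -/

theorem abs_det_toSpanSingleton_restrictScalars (c : ℂ) :
    |((ContinuousLinearMap.toSpanSingleton ℂ c).restrictScalars ℝ).det| = ‖c‖ ^ 2 := by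
  have h : (((ContinuousLinearMap.toSpanSingleton ℂ c).restrictScalars ℝ : ℂ →L[ℝ] ℂ) : ℂ →ₗ[ℝ] ℂ)
      = Algebra.lmul ℝ ℂ c := by
    ext
    simp [mul_comm]
  rw [ContinuousLinearMap.det, h]
  have := Algebra.norm_complex_apply c
  rw [Algebra.norm_apply] at this
  rw [this, Complex.normSq_eq_norm_sq, abs_of_nonneg (by positivity)]

/-- The real Jacobian of a holomorphic map is `‖g'‖ ^ 2`, so an injective one whose derivative is
bounded below by `δ` expands areas by a factor of at least `δ ^ 2`. -/
theorem ofReal_sq_mul_volume_le_volume_image {g g' : ℂ → ℂ} {s : Set ℂ} (hs : MeasurableSet s)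
    (hg : ∀ z ∈ s, HasDerivAt g (g' z) z) (hinj : InjOn g s) {δ : ℝ} (hδ : 0 ≤ δ)
    (hle : ∀ z ∈ s, δ ≤ ‖g' z‖) :
    ENNReal.ofReal (δ ^ 2) * volume s ≤ volume (g '' s) := by
  rw [← lintegral_abs_det_fderiv_eq_addHaar_image volume hs
    (fun z hz => ((hg z hz).hasFDerivAt.restrictScalars ℝ).hasFDerivWithinAt) hinj,
    ← setLIntegral_const]
  refine setLIntegral_mono' hs fun z hz => ENNReal.ofReal_le_ofReal ?_
  rw [abs_det_toSpanSingleton_restrictScalars]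
  exact pow_le_pow_left₀ hδ (hle z hz) 2

/-- The area of the preimage of `B` under `z ↦ z ^ m` is at most a constant times
`(area of B) ^ (1 / m)`. -/
theorem exists_volume_preimage_pow_le {m : ℕ} (hm : m ≠ 0) :
    ∃ C : ℝ, ∀ t : ℝ, 0 < t → ∀ B : Set ℂ, MeasurableSet B →
      volume B ≤ ENNReal.ofReal (t ^ m) →
      volume ((fun z : ℂ => z ^ m) ⁻¹' B) ≤ ENNReal.ofReal (C * t) := by
  refine ⟨m * (Real.pi + 1), fun t ht B hB hBt => ?_⟩
  -- `S` is the image of `B` under the principal branch of the `m`-th root.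
  set S : Set ℂ := {z | z ^ m ∈ B ∧ (z ^ m) ^ (m⁻¹ : ℂ) = z} with hS
  have hSm : MeasurableSet S := by
    have h1 : Measurable fun z : ℂ => z ^ m := by fun_prop
    exact (h1 hB).inter (measurableSet_eq_fun (by fun_prop) measurable_id)
  have hSinj : InjOn (fun z : ℂ => z ^ m) S := by
    intro z hz w hw h
    rw [← hz.2, ← hw.2]
    simp only at h
    rw [h]
  have hSvol : volume S ≤ ENNReal.ofReal ((Real.pi + 1) * t) := by
    -- The radius `√t` balances the area of the disc, `π * t`, against the bound `t ^ m / t ^ (m - 1)`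
    -- for the part outside it.
    have hr : 0 < √t := Real.sqrt_pos.2 ht
    have h1 : volume (S \ Metric.ball 0 √t) ≤ ENNReal.ofReal t := by
      have := ofReal_sq_mul_volume_le_volume_image (g := fun z : ℂ => z ^ m)
        (g' := fun z => m * z ^ (m - 1)) (δ := √t ^ (m - 1)) (s := S \ Metric.ball 0 √t)
        (hSm.diff Metric.isOpen_ball.measurableSet)
        (fun z _ => hasDerivAt_pow m z) (hSinj.mono sdiff_subset) (by positivity) (by
          intro z hz
          have hz2 : √t ≤ ‖z‖ := by
            simpa only [Metric.mem_ball, dist_zero_right, not_lt] using hz.2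
          rw [norm_mul, norm_pow, Complex.norm_natCast]
          have h1 : (1 : ℝ) ≤ m := by exact_mod_cast Nat.one_le_iff_ne_zero.2 hm
          calc √t ^ (m - 1) ≤ ‖z‖ ^ (m - 1) := pow_le_pow_left₀ hr.le hz2 _
            _ ≤ m * ‖z‖ ^ (m - 1) := le_mul_of_one_le_left (by positivity) h1)
      have h2 : (√t ^ (m - 1)) ^ 2 = t ^ (m - 1) := by
        rw [← pow_mul, mul_comm, pow_mul, Real.sq_sqrt ht.le]
      have h3 : volume ((fun z : ℂ => z ^ m) '' (S \ Metric.ball 0 √t)) ≤ volume B :=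
        measure_mono (by rintro _ ⟨z, hz, rfl⟩; exact hz.1.1)
      rw [h2] at this
      have h4 := (this.trans h3).trans hBt
      have h5 : t ^ m = t ^ (m - 1) * t := by
        rw [← pow_succ, Nat.sub_add_cancel (Nat.pos_of_ne_zero hm)]
      rw [h5, ENNReal.ofReal_mul (by positivity)] at h4
      exact (ENNReal.mul_le_mul_iff_right (by simp; positivity) ENNReal.ofReal_ne_top).1 h4
    calc volume S ≤ volume (Metric.ball (0 : ℂ) √t) + volume (S \ Metric.ball 0 √t) := by
          refine (measure_mono ?_).trans (measure_union_le _ _)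
          intro z hz
          by_cases h : z ∈ Metric.ball (0 : ℂ) √t
          · exact Or.inl h
          · exact Or.inr ⟨hz, h⟩
      _ ≤ ENNReal.ofReal (Real.pi * t) + ENNReal.ofReal t := by
          refine add_le_add ?_ h1
          rw [Complex.volume_ball, ← ENNReal.ofReal_pow hr.le, Real.sq_sqrt ht.le, mul_comm,
            ENNReal.ofReal_mul Real.pi_pos.le]
          gcongr
          rw [← NNReal.coe_real_pi, ENNReal.ofReal_coe_nnreal]
      _ = _ := by rw [← ENNReal.ofReal_add (by positivity) ht.le]; ring_nf
  -- Multiplying by a suitable `m`-th root of unity turns a point into the principal root of its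
  -- `m`-th power.
  have hcover : (fun z : ℂ => z ^ m) ⁻¹' B ⊆
      ⋃ ζ ∈ Polynomial.nthRootsFinset m (1 : ℂ), (fun z : ℂ => ζ * z) ⁻¹' S := by
    intro z hz
    have hu : ((z ^ m) ^ (m⁻¹ : ℂ)) ^ m = z ^ m := Complex.cpow_nat_inv_pow _ hm
    have huS : (z ^ m) ^ (m⁻¹ : ℂ) ∈ S := by
      refine ⟨?_, ?_⟩
      · rw [hu]; exact hz
      · rw [hu]
    simp only [mem_iUnion, mem_preimage, exists_prop,
      Polynomial.mem_nthRootsFinset (Nat.pos_of_ne_zero hm)]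
    by_cases h0 : z = 0
    · refine ⟨1, one_pow m, ?_⟩
      have : (z ^ m) ^ (m⁻¹ : ℂ) = z := by
        subst h0
        rw [zero_pow hm, Complex.zero_cpow]
        simpa using hm
      rwa [one_mul, ← this]
    · refine ⟨(z ^ m) ^ (m⁻¹ : ℂ) / z, ?_, ?_⟩
      · rw [div_pow, hu, div_self (pow_ne_zero m h0)]
      · rwa [div_mul_cancel₀ _ h0]
  have hrot : ∀ ζ ∈ Polynomial.nthRootsFinset m (1 : ℂ),
      volume ((fun z : ℂ => ζ * z) ⁻¹' S) ≤ volume S := by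
    intro ζ hζ
    rw [Polynomial.mem_nthRootsFinset (Nat.pos_of_ne_zero hm)] at hζ
    have hn : ‖ζ‖ = 1 := Complex.norm_eq_one_of_pow_eq_one hζ hm
    have h0 : ζ ≠ 0 := by rintro rfl; simp at hn
    have := ofReal_sq_mul_volume_le_volume_image (g := fun z : ℂ => ζ * z) (g' := fun _ => ζ)
      (δ := 1) (s := (fun z : ℂ => ζ * z) ⁻¹' S) ((measurable_const_mul ζ) hSm)
      (fun z _ => by simpa using (hasDerivAt_id z).const_mul ζ)
      (mul_right_injective₀ h0).injOn zero_le_one (fun _ _ => hn.ge)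
    rw [one_pow, ENNReal.ofReal_one, one_mul] at this
    exact this.trans (measure_mono (image_preimage_subset _ _))
  calc volume ((fun z : ℂ => z ^ m) ⁻¹' B)
      ≤ ∑ ζ ∈ Polynomial.nthRootsFinset m (1 : ℂ), volume ((fun z : ℂ => ζ * z) ⁻¹' S) :=
        (measure_mono hcover).trans (measure_biUnion_finset_le _ _)
    _ ≤ ∑ ζ ∈ Polynomial.nthRootsFinset m (1 : ℂ), ENNReal.ofReal ((Real.pi + 1) * t) :=
        Finset.sum_le_sum fun ζ hζ => (hrot ζ hζ).trans hSvol
    _ = ENNReal.ofReal (m * (Real.pi + 1) * t) := by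
        rw [Finset.sum_const, (Complex.isPrimitiveRoot_exp m hm).card_nthRootsFinset,
          nsmul_eq_mul, mul_assoc, ENNReal.ofReal_mul (by positivity : (0:ℝ) ≤ m),
          ENNReal.ofReal_natCast]

/-! ### Local normal form of analytic functions -/

/-- A nonconstant analytic function is a power of a local coordinate, up to an additive constant. -/
theorem AnalyticAt.exists_eq_add_pow {g : ℂ → ℂ} {z₀ : ℂ} (hg : AnalyticAt ℂ g z₀)
    (hne : ¬ ∀ᶠ z in 𝓝 z₀, g z = g z₀) :
    ∃ m : ℕ, m ≠ 0 ∧ ∃ φ : ℂ → ℂ, AnalyticAt ℂ φ z₀ ∧ φ z₀ = 0 ∧ deriv φ z₀ ≠ 0 ∧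
      ∀ᶠ z in 𝓝 z₀, g z = g z₀ + φ z ^ m := by
  have hsub : AnalyticAt ℂ (fun z => g z - g z₀) z₀ := hg.sub analyticAt_const
  have htop : analyticOrderAt (fun z => g z - g z₀) z₀ ≠ ⊤ := by
    intro h
    refine hne ?_
    filter_upwards [analyticOrderAt_eq_top.1 h] with z hz using sub_eq_zero.1 hz
  obtain ⟨m, hm⟩ := ENat.ne_top_iff_exists.1 htop
  obtain ⟨h, hh, hh0, hgh⟩ := hsub.analyticOrderAt_eq_natCast.1 hm.symm
  have hm0 : m ≠ 0 := by
    rintro rfl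
    have := hgh.self_of_nhds
    simp at this
    exact hh0 this.symm
  -- With `g z - g z₀ = (z - z₀) ^ m * h z`, an analytic `m`-th root of `h` is
  -- `a * (h z / h z₀) ^ (1 / m)`: the quotient is close to `1`, where the principal branch is analytic.
  obtain ⟨a, ha⟩ : ∃ a : ℂ, a ^ m = h z₀ := ⟨_, Complex.cpow_nat_inv_pow (h z₀) hm0⟩
  have ha0 : a ≠ 0 := by rintro rfl; exact hh0 (by rw [← ha, zero_pow hm0])
  have hq : AnalyticAt ℂ (fun z => (h z / h z₀) ^ (m⁻¹ : ℂ)) z₀ := by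
    refine (hh.div analyticAt_const hh0).cpow analyticAt_const ?_
    simp [div_self hh0]
  have hφ : AnalyticAt ℂ (fun z => (z - z₀) * (a * (h z / h z₀) ^ (m⁻¹ : ℂ))) z₀ :=
    (analyticAt_id.sub analyticAt_const).mul (analyticAt_const.mul hq)
  refine ⟨m, hm0, _, hφ, by simp, ?_, ?_⟩
  · have h1 := ((hasDerivAt_id z₀).sub_const z₀).mul
      ((analyticAt_const (v := a)).mul hq).differentiableAt.hasDerivAt
    have h2 : deriv (fun z => (z - z₀) * (a * (h z / h z₀) ^ (m⁻¹ : ℂ))) z₀ = a := by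
      refine (HasDerivAt.deriv h1).trans ?_
      simp [div_self hh0]
    rw [h2]; exact ha0
  · filter_upwards [hgh] with z hz
    rw [mul_pow, mul_pow, Complex.cpow_nat_inv_pow _ hm0, ha, mul_div_cancel₀ _ hh0]
    rw [smul_eq_mul] at hz
    rw [← hz]; ring

theorem ContinuousOn.measurableSet_inter_preimage {α β : Type*} [TopologicalSpace α]
    [MeasurableSpace α] [BorelSpace α] [TopologicalSpace β] [MeasurableSpace β] [BorelSpace β]
    {φ : α → β} {W : Set α} (hφ : ContinuousOn φ W) (hW : MeasurableSet W) {E : Set β}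
    (hE : MeasurableSet E) : MeasurableSet (W ∩ φ ⁻¹' E) := by
  have h := hφ.domRestrict.measurable hE
  have h2 := (MeasurableEmbedding.subtype_coe hW).measurableSet_image.2 h
  convert h2 using 1
  ext z
  simp [and_comm]

/-- The local multiplicity `m` of a nonconstant analytic function controls two things: values close
to `g z₀` are taken at least `m` times near `z₀`, and the area of the preimage of `B` near `z₀` is at
most a constant times `(area of B) ^ (1 / m)`. -/
theorem AnalyticAt.exists_order {g : ℂ → ℂ} {z₀ : ℂ} (hg : AnalyticAt ℂ g z₀)
    (hne : ¬ ∀ᶠ z in 𝓝 z₀, g z = g z₀) :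
    ∃ m : ℕ, m ≠ 0 ∧
      (∀ U ∈ 𝓝 z₀, ∀ᶠ w in 𝓝 (g z₀), w ≠ g z₀ → (m : ℕ∞) ≤ (U ∩ g ⁻¹' {w}).encard) ∧
      ∃ U ∈ 𝓝 z₀, ∃ C : ℝ, ∀ t : ℝ, 0 < t → ∀ B : Set ℂ, MeasurableSet B →
        volume B ≤ ENNReal.ofReal (t ^ m) → volume (U ∩ g ⁻¹' B) ≤ ENNReal.ofReal (C * t) := by
  obtain ⟨m, hm, φ, hφ, hφ0, hφ', hgφ⟩ := hg.exists_eq_add_pow hne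
  have hstrict : HasStrictDerivAt φ (deriv φ z₀) z₀ := hφ.hasStrictDerivAt
  refine ⟨m, hm, fun U hU => ?_, ?_⟩
  · have hUφ : φ '' (U ∩ {z | g z = g z₀ + φ z ^ m}) ∈ 𝓝 (0 : ℂ) := by
      rw [← hφ0, ← hstrict.map_nhds_eq hφ']
      exact image_mem_map (inter_mem hU hgφ)
    obtain ⟨r, hr, hball⟩ := Metric.mem_nhds_iff.1 hUφ
    filter_upwards [Metric.ball_mem_nhds (g z₀) (pow_pos hr m)] with w hw hne'
    have hw0 : w - g z₀ ≠ 0 := sub_ne_zero.2 hne'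
    -- Each of the `m` distinct `m`-th roots of `w - g z₀` is a value of `φ` on `U`.
    set R := Polynomial.nthRoots m (w - g z₀) with hR
    have hcard : R.toFinset.card = m := by
      have hprim := Complex.isPrimitiveRoot_exp m hm
      rw [Multiset.toFinset_card_of_nodup (hprim.nthRoots_nodup hw0), hprim.card_nthRoots,
        if_pos ⟨_, Complex.cpow_nat_inv_pow _ hm⟩]
    have hsub : (R.toFinset : Set ℂ) ⊆ φ '' (U ∩ g ⁻¹' {w}) := by
      intro u hu
      have hu' : u ^ m = w - g z₀ := by
        simpa [hR, Polynomial.mem_nthRoots (Nat.pos_of_ne_zero hm)] using hu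
      have hub : u ∈ Metric.ball (0 : ℂ) r := by
        rw [mem_ball_zero_iff]
        refine lt_of_pow_lt_pow_left₀ m hr.le ?_
        rw [← norm_pow, hu', ← dist_eq_norm]
        exact hw
      obtain ⟨z, ⟨hzU, hz⟩, rfl⟩ := hball hub
      refine ⟨z, ⟨hzU, ?_⟩, rfl⟩
      rw [mem_preimage, mem_singleton_iff, hz, hu']; ring
    calc (m : ℕ∞) = (R.toFinset : Set ℂ).encard := by rw [Set.encard_coe_eq_coe_finsetCard, hcard]
      _ ≤ (φ '' (U ∩ g ⁻¹' {w})).encard := encard_le_encard hsub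
      _ ≤ _ := encard_image_le _ _
  · obtain ⟨C, hC⟩ := exists_volume_preimage_pow_le hm
    set δ := ‖deriv φ z₀‖ / 2 with hδ
    have hδ0 : 0 < δ := half_pos (norm_pos_iff.2 hφ')
    set ψ := HasStrictFDerivAt.toOpenPartialHomeomorph φ
      (HasStrictDerivAt.hasStrictFDerivAt_equiv hstrict hφ')
    have hinj : ∀ᶠ z in 𝓝 z₀, z ∈ ψ.source := ψ.open_source.mem_nhds
      (HasStrictFDerivAt.mem_toOpenPartialHomeomorph_source
        (HasStrictDerivAt.hasStrictFDerivAt_equiv hstrict hφ'))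
    have hderiv : ∀ᶠ z in 𝓝 z₀, δ ≤ ‖deriv φ z‖ :=
      (hφ.deriv.continuousAt.norm.eventually (lt_mem_nhds (half_lt_self (norm_pos_iff.2 hφ')))).mono
        fun z hz => hz.le
    obtain ⟨W, hWsub, hWo, hzW⟩ := mem_nhds_iff.1
      (((hinj.and hderiv).and (hφ.eventually_analyticAt.and hgφ)))
    refine ⟨W, hWo.mem_nhds hzW, C / δ ^ 2, fun t ht B hB hBt => ?_⟩
    have hB' : MeasurableSet ((fun z => g z₀ + z) ⁻¹' B) := (measurable_const_add (g z₀)) hB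
    have hE := hC t ht _ hB' (by rwa [measure_preimage_add])
    have hEm : MeasurableSet ((fun z : ℂ => z ^ m) ⁻¹' ((fun z => g z₀ + z) ⁻¹' B)) :=
      (continuous_pow m).measurable hB'
    set E := (fun z : ℂ => z ^ m) ⁻¹' ((fun z => g z₀ + z) ⁻¹' B)
    have hcont : ContinuousOn φ W := fun z hz => (hWsub hz).2.1.continuousAt.continuousWithinAt
    have hset : W ∩ g ⁻¹' B = W ∩ φ ⁻¹' E := by
      ext z
      refine and_congr_right fun hz => ?_
      simp only [mem_preimage, E, (hWsub hz).2.2]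
    have hle := ofReal_sq_mul_volume_le_volume_image
      (hcont.measurableSet_inter_preimage hWo.measurableSet hEm)
      (fun z hz => (hWsub hz.1).2.1.differentiableAt.hasDerivAt)
      (ψ.injOn.mono fun z hz => (hWsub hz.1).1.1) hδ0.le
      (fun z hz => (hWsub hz.1).1.2)
    rw [hset]
    have himg : volume (φ '' (W ∩ φ ⁻¹' E)) ≤ ENNReal.ofReal (C * t) :=
      (measure_mono (by rintro _ ⟨z, hz, rfl⟩; exact hz.2)).trans hE
    rw [div_mul_eq_mul_div, ENNReal.ofReal_div_of_pos (by positivity),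
      ENNReal.le_div_iff_mul_le (Or.inl (by simp; positivity)) (Or.inl ENNReal.ofReal_ne_top),
      mul_comm]
    exact hle.trans himg

/-! ### Holomorphic self-maps with a topological degree -/

theorem MDifferentiable.analyticAt_chartAt {X : Type*} [TopologicalSpace X] [ChartedSpace ℂ X]
    [IsManifold 𝓘(ℂ) ω X] {f : X → X} (hf : MDifferentiable 𝓘(ℂ) 𝓘(ℂ) f) (x y : X) {z : ℂ}
    (hz : z ∈ (chartAt ℂ x).target) (hfz : f ((chartAt ℂ x).symm z) ∈ (chartAt ℂ y).source) :
    AnalyticAt ℂ (chartAt ℂ y ∘ f ∘ (chartAt ℂ x).symm) z := by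
  have h := (mdifferentiable_iff.1 hf).2 x y
  simp only [mfld_simps] at h
  have hopen : IsOpen ((chartAt ℂ x).target ∩
      (chartAt ℂ x).symm ⁻¹' (f ⁻¹' (chartAt ℂ y).source)) :=
    (chartAt ℂ x).isOpen_inter_preimage_symm ((chartAt ℂ y).open_source.preimage hf.continuous)
  exact h.analyticAt (hopen.mem_nhds ⟨hz, hfz⟩)

theorem ChartedSpace.infinite_complex (X : Type*) [TopologicalSpace X] [ChartedSpace ℂ X]
    [Nonempty X] : Infinite X := by
  obtain ⟨x⟩ := ‹Nonempty X›
  have h : (chartAt ℂ x).target.Infinite :=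
    infinite_of_mem_nhds _ ((chartAt ℂ x).open_target.mem_nhds (mem_chart_target ℂ x))
  have := h.image (chartAt ℂ x).symm.injOn
  exact (infinite_univ_iff.1 (this.mono (subset_univ _)))

/-- A holomorphic self-map with a nonzero topological degree is nowhere locally constant: the set of
points near which it is constant is open and closed, and a constant map would leave infinitely many
points without preimage. -/
theorem HasTopologicalDegree.not_eventually_eq {X : Type*} [TopologicalSpace X] [ConnectedSpace X]
    [ChartedSpace ℂ X] [IsManifold 𝓘(ℂ) ω X] {f : X → X} (hf : MDifferentiable 𝓘(ℂ) 𝓘(ℂ) f)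
    {d : ℕ} (hd : d ≠ 0) (hdeg : HasTopologicalDegree f d) (x : X) :
    ¬ ∀ᶠ p in 𝓝 x, f p = f x := by
  set A : Set X := {x | ∀ᶠ p in 𝓝 x, f p = f x} with hA
  have hAo : IsOpen A := by
    rw [isOpen_iff_mem_nhds]
    intro x hx
    have hx' : ∀ᶠ p in 𝓝 x, f p = f x := hx
    filter_upwards [hx', eventually_eventually_nhds.2 hx'] with q hq hq'
    rw [← hq] at hq'
    exact hq'
  have hAc : IsClosed A := by
    refine isClosed_of_closure_subset fun x hx => ?_
    set e := chartAt ℂ x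
    set e' := chartAt ℂ (f x)
    have hV : e.target ∩ e.symm ⁻¹' (f ⁻¹' e'.source) ∈ 𝓝 (e x) :=
      (e.isOpen_inter_preimage_symm (e'.open_source.preimage hf.continuous)).mem_nhds
        ⟨mem_chart_target ℂ x, by
          rw [mem_preimage, mem_preimage, e.left_inv (mem_chart_source ℂ x)]
          exact mem_chart_source ℂ (f x)⟩
    obtain ⟨r, hr, hball⟩ := Metric.mem_nhds_iff.1 hV
    have hg : AnalyticOnNhd ℂ (e' ∘ f ∘ e.symm) (Metric.ball (e x) r) := fun z hz =>
      hf.analyticAt_chartAt x (f x) (hball hz).1 (hball hz).2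
    have hU : e.source ∩ e ⁻¹' Metric.ball (e x) r ∈ 𝓝 x :=
      (e.isOpen_inter_preimage Metric.isOpen_ball).mem_nhds
        ⟨mem_chart_source ℂ x, Metric.mem_ball_self hr⟩
    obtain ⟨q, hqU, hqA⟩ := mem_closure_iff_nhds.1 hx _ hU
    have hq : ∀ᶠ z in 𝓝 (e q), (e' ∘ f ∘ e.symm) z = e' (f q) := by
      have h1 : Tendsto e.symm (𝓝 (e q)) (𝓝 q) := by
        have := e.continuousAt_symm (e.map_source hqU.1)
        rwa [ContinuousAt, e.left_inv hqU.1] at this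
      have hqA' : ∀ᶠ p in 𝓝 q, f p = f q := hqA
      filter_upwards [h1.eventually hqA'] with z hz
      simp [hz]
    -- The map is constant near `q`, hence on the whole coordinate disc around `x`.
    have hEq := hg.eqOn_of_preconnected_of_eventuallyEq (g := fun _ => e' (f q))
      (fun _ _ => analyticAt_const)
      (convex_ball _ _).isPreconnected hqU.2 hq
    have hfin : ∀ p ∈ e.source ∩ e ⁻¹' Metric.ball (e x) r, f p = f q := by
      have key : ∀ p ∈ e.source ∩ e ⁻¹' Metric.ball (e x) r,
          f p ∈ e'.source ∧ e' (f p) = e' (f q) := by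
        intro p hp
        have h1 := (hball hp.2).2
        have h2 := hEq hp.2
        simp only [mem_preimage, Function.comp_apply, e.left_inv hp.1] at h1 h2
        exact ⟨h1, h2⟩
      exact fun p hp => e'.injOn (key p hp).1 (key q hqU).1 (key p hp).2
    have hx0 := hfin x ⟨mem_chart_source ℂ x, Metric.mem_ball_self hr⟩
    change ∀ᶠ p in 𝓝 x, f p = f x
    filter_upwards [hU] with p hp
    rw [hfin p hp, hx0]
  intro hx
  have hAuniv : A = univ := IsClopen.eq_univ ⟨hAc, hAo⟩ ⟨x, hx⟩
  have hconst : ∀ p, f p = f x := fun p =>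
    ((IsLocallyConstant.iff_eventually_eq f).2 fun q =>
      (hAuniv ▸ mem_univ q : q ∈ A)).apply_eq_of_preconnectedSpace p x
  obtain ⟨S, hS, hSd⟩ := hdeg
  have : Infinite X := ChartedSpace.infinite_complex X
  obtain ⟨y, hy⟩ := (hS.insert (f x)).exists_notMem
  have h1 := hSd y fun h => hy (mem_insert_of_mem _ h)
  have h2 : f ⁻¹' {y} = ∅ := by
    ext p
    simp only [mem_preimage, mem_singleton_iff, mem_empty_iff_false, iff_false]
    rintro rfl
    exact hy (by rw [hconst p]; exact mem_insert _ _)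
  rw [h2, encard_empty] at h1
  exact hd (by exact_mod_cast h1.symm)

/-- In the preferred charts at `x` and `f x`, the area bound for preimages near `x` holds with the
local multiplicity `m` of `f`, which is at most the topological degree. -/
theorem HasTopologicalDegree.exists_order_le {X : Type*} [TopologicalSpace X] [ConnectedSpace X]
    [ChartedSpace ℂ X] [IsManifold 𝓘(ℂ) ω X] {f : X → X} (hf : MDifferentiable 𝓘(ℂ) 𝓘(ℂ) f)
    {d : ℕ} (hd : d ≠ 0) (hdeg : HasTopologicalDegree f d) (x : X) :
    ∃ m ≤ d, m ≠ 0 ∧ ∃ U ∈ 𝓝 (chartAt ℂ x x), ∃ C : ℝ, ∀ t : ℝ, 0 < t → ∀ B : Set ℂ,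
      MeasurableSet B → volume B ≤ ENNReal.ofReal (t ^ m) →
      volume (U ∩ (chartAt ℂ (f x) ∘ f ∘ (chartAt ℂ x).symm) ⁻¹' B) ≤ ENNReal.ofReal (C * t) := by
  have hnc := hdeg.not_eventually_eq hf hd x
  set e := chartAt ℂ x
  set e' := chartAt ℂ (f x)
  have hex : e.symm (e x) = x := e.left_inv (mem_chart_source ℂ x)
  have hV : e.target ∩ e.symm ⁻¹' (f ⁻¹' e'.source) ∈ 𝓝 (e x) :=
    (e.isOpen_inter_preimage_symm (e'.open_source.preimage hf.continuous)).mem_nhds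
      ⟨mem_chart_target ℂ x, by
        rw [mem_preimage, mem_preimage, hex]
        exact mem_chart_source ℂ (f x)⟩
  have hg : AnalyticAt ℂ (e' ∘ f ∘ e.symm) (e x) :=
    hf.analyticAt_chartAt x (f x) (mem_of_mem_nhds hV).1 (mem_of_mem_nhds hV).2
  have hgx : (e' ∘ f ∘ e.symm) (e x) = e' (f x) := by simp [hex]
  have hne : ¬ ∀ᶠ z in 𝓝 (e x), (e' ∘ f ∘ e.symm) z = (e' ∘ f ∘ e.symm) (e x) := by
    intro h
    refine hnc ?_
    filter_upwards [(e.continuousAt (mem_chart_source ℂ x)).eventually (h.and hV),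
      e.open_source.mem_nhds (mem_chart_source ℂ x)] with p hp hpe
    obtain ⟨h1, -, h2⟩ := hp
    rw [hgx] at h1
    simp only [Function.comp_apply, mem_preimage, e.left_inv hpe] at h1 h2
    exact e'.injOn h2 (mem_chart_source ℂ (f x)) h1
  obtain ⟨m, hm, hcount, hvol⟩ := hg.exists_order hne
  refine ⟨m, ?_, hm, hvol⟩
  obtain ⟨S, hS, hSd⟩ := hdeg
  -- Nearby values `w` other than that of `x` lie off the finite exceptional set, so that counting
  -- their preimages compares `m` with `d`.
  have hev : ∀ᶠ w in 𝓝[≠] (e' (f x)), w ∈ e'.target ∧ w ∉ e' '' S ∧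
      (m : ℕ∞) ≤ ((e.target ∩ e.symm ⁻¹' (f ⁻¹' e'.source)) ∩
        (e' ∘ f ∘ e.symm) ⁻¹' {w}).encard := by
    have h1 := hcount _ hV
    rw [hgx] at h1
    have h2 : (e' '' S \ {e' (f x)})ᶜ ∈ 𝓝 (e' (f x)) :=
      ((hS.image e').sdiff).isClosed.isOpen_compl.mem_nhds (by simp)
    filter_upwards [nhdsWithin_le_nhds h1, nhdsWithin_le_nhds h2, self_mem_nhdsWithin,
      nhdsWithin_le_nhds (e'.open_target.mem_nhds (mem_chart_target ℂ (f x)))] with w h1 h2 h3 h4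
    exact ⟨h4, fun h => h2 ⟨h, h3⟩, h1 h3⟩
  obtain ⟨w, hwt, hwS, hw⟩ := hev.exists
  have h1 := hSd (e'.symm w) fun h => hwS ⟨_, h, e'.right_inv hwt⟩
  have h2 : ((e.target ∩ e.symm ⁻¹' (f ⁻¹' e'.source)) ∩ (e' ∘ f ∘ e.symm) ⁻¹' {w}).encard ≤
      (f ⁻¹' {e'.symm w}).encard := by
    refine encard_le_encard_of_injOn (f := e.symm) ?_ (e.symm.injOn.mono fun z hz => hz.1.1)
    rintro z ⟨hz, hzw⟩
    have hzw' : e' (f (e.symm z)) = w := hzw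
    rw [mem_preimage, mem_singleton_iff, ← hzw', e'.left_inv hz.2]
  rw [h1] at h2
  exact_mod_cast hw.trans h2

/-! ### Smooth volumes -/

theorem OpenPartialHomeomorph.measurableSet_image {X Y : Type*} [TopologicalSpace X]
    [MeasurableSpace X] [BorelSpace X] [TopologicalSpace Y] [MeasurableSpace Y] [BorelSpace Y]
    (e : OpenPartialHomeomorph X Y) {A : Set X} (hA : MeasurableSet A) (hAe : A ⊆ e.source) :
    MeasurableSet (e '' A) := by
  rw [e.image_eq_target_inter_inv_preimage hAe]
  exact e.continuousOn_symm.measurableSet_inter_preimage e.open_target.measurableSet hA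

/-- Near each point, a smooth volume is finite and comparable to Lebesgue measure in the preferred
chart. -/
theorem IsSmoothVolume.exists_local_bounds {X : Type*} [TopologicalSpace X] [ChartedSpace ℂ X]
    [MeasurableSpace X] [BorelSpace X] {vol : Measure X} (hvol : IsSmoothVolume vol) (x : X) :
    ∃ U : Set X, IsOpen U ∧ x ∈ U ∧ U ⊆ (chartAt ℂ x).source ∧ vol U < ⊤ ∧
      ∃ a b : ℝ, 0 < a ∧ 0 < b ∧ ∀ A : Set X, MeasurableSet A → A ⊆ U →
        ENNReal.ofReal a * volume (chartAt ℂ x '' A) ≤ vol A ∧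
        vol A ≤ ENNReal.ofReal b * volume (chartAt ℂ x '' A) := by
  obtain ⟨ρ, hρ, hpos, hint⟩ := hvol _ (chart_mem_atlas ℂ x)
  set e := chartAt ℂ x
  have hx : x ∈ e.source := mem_chart_source ℂ x
  have ht : e x ∈ e.target := mem_chart_target ℂ x
  have hρx : 0 < ρ (e x) := hpos _ ht
  have hcont : ContinuousAt ρ (e x) := hρ.continuousOn.continuousAt (e.open_target.mem_nhds ht)
  have hev : ∀ᶠ z in 𝓝 (e x), ρ (e x) / 2 ≤ ρ z ∧ ρ z ≤ 2 * ρ (e x) ∧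
      z ∈ Metric.ball (e x) 1 := by
    filter_upwards [hcont.eventually (lt_mem_nhds (half_lt_self hρx)),
      hcont.eventually (gt_mem_nhds (lt_two_mul_self hρx)), Metric.ball_mem_nhds _ one_pos]
      with z h1 h2 h3
    exact ⟨h1.le, h2.le, h3⟩
  obtain ⟨W, hW, hWo, hxW⟩ := mem_nhds_iff.1 hev
  have hbounds : ∀ A : Set X, MeasurableSet A → A ⊆ e.source ∩ e ⁻¹' W →
      ENNReal.ofReal (ρ (e x) / 2) * volume (e '' A) ≤ vol A ∧
        vol A ≤ ENNReal.ofReal (2 * ρ (e x)) * volume (e '' A) := by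
    intro A hA hAU
    have hAs : A ⊆ e.source := hAU.trans inter_subset_left
    have hm := e.measurableSet_image hA hAs
    have hAW : ∀ z ∈ e '' A, z ∈ W := by
      rintro _ ⟨p, hp, rfl⟩
      exact (hAU hp).2
    rw [hint A hA hAs, ← setLIntegral_const, ← setLIntegral_const]
    exact ⟨setLIntegral_mono' hm fun z hz => ENNReal.ofReal_le_ofReal (hW (hAW z hz)).1,
      setLIntegral_mono' hm fun z hz => ENNReal.ofReal_le_ofReal (hW (hAW z hz)).2.1⟩
  have hUo : IsOpen (e.source ∩ e ⁻¹' W) := e.isOpen_inter_preimage hWo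
  refine ⟨_, hUo, ⟨hx, hxW⟩, inter_subset_left, ?_, _, _, half_pos hρx, by positivity, hbounds⟩
  refine (hbounds _ hUo.measurableSet Subset.rfl).2.trans_lt
    (ENNReal.mul_lt_top ENNReal.ofReal_lt_top ?_)
  refine (measure_mono ?_).trans_lt (measure_ball_lt_top (x := e x) (r := 1))
  rintro _ ⟨p, hp, rfl⟩
  exact (hW hp.2).2.2

theorem IsSmoothVolume.isFiniteMeasure {X : Type*} [TopologicalSpace X] [CompactSpace X]
    [ChartedSpace ℂ X] [MeasurableSpace X] [BorelSpace X] {vol : Measure X}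
    (hvol : IsSmoothVolume vol) : IsFiniteMeasure vol := by
  have : IsLocallyFiniteMeasure vol := ⟨fun x => by
    obtain ⟨U, hUo, hxU, -, hfin, -⟩ := hvol.exists_local_bounds x
    exact ⟨U, hUo.mem_nhds hxU, hfin⟩⟩
  infer_instance

/-! ### Volumes of preimages and images -/

/-- The local form of the bound on volumes of preimages; the restriction `t ≤ 1` allows the
multiplicity at `x` to be replaced by the larger exponent `d`. -/
theorem exists_nhds_volume_preimage_le {X : Type*} [TopologicalSpace X]
    [ConnectedSpace X] [ChartedSpace ℂ X] [IsManifold 𝓘(ℂ) ω X]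
    [MeasurableSpace X] [BorelSpace X] {vol : Measure X} (hvol : IsSmoothVolume vol)
    {f : X → X} (hf : MDifferentiable 𝓘(ℂ) 𝓘(ℂ) f)
    {d : ℕ} (hd : d ≠ 0) (hdeg : HasTopologicalDegree f d) (x : X) :
    ∃ U ∈ 𝓝 x, ∃ K : ℝ, ∀ t : ℝ, 0 < t → t ≤ 1 → ∀ B : Set X, MeasurableSet B →
      vol B ≤ ENNReal.ofReal (t ^ d) → vol (U ∩ f ⁻¹' B) ≤ ENNReal.ofReal (K * t) := by
  obtain ⟨m, hmd, hm, W, hW, C, hC⟩ := hdeg.exists_order_le hf hd x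
  obtain ⟨U₀, hU₀o, hxU₀, hU₀s, -, _, b, -, hb, hU₀⟩ := hvol.exists_local_bounds x
  obtain ⟨V₀, hV₀o, hxV₀, hV₀s, -, a, _, ha, -, hV₀⟩ := hvol.exists_local_bounds (f x)
  set e := chartAt ℂ x
  set e' := chartAt ℂ (f x)
  have hnhds : U₀ ∩ f ⁻¹' V₀ ∩ e ⁻¹' W ∈ 𝓝 x :=
    inter_mem (inter_mem (hU₀o.mem_nhds hxU₀)
      ((hV₀o.preimage hf.continuous).mem_nhds hxV₀))
      ((e.continuousAt (mem_chart_source ℂ x)).preimage_mem_nhds hW)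
  obtain ⟨U, hU, hUo, hxU⟩ := mem_nhds_iff.1 hnhds
  refine ⟨U, hUo.mem_nhds hxU, b * (C * (1 + a⁻¹)), fun t ht ht1 B hB hBt => ?_⟩
  have hBV : MeasurableSet (B ∩ V₀) := hB.inter hV₀o.measurableSet
  have hB'm : MeasurableSet (e' '' (B ∩ V₀)) :=
    e'.measurableSet_image hBV (inter_subset_right.trans hV₀s)
  -- The factor `1 + a⁻¹` absorbs the distortion `a⁻¹` of the volume in the target chart:
  -- `a⁻¹ ≤ (1 + a⁻¹) ^ m`.
  have hB' : volume (e' '' (B ∩ V₀)) ≤ ENNReal.ofReal (((1 + a⁻¹) * t) ^ m) := by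
    have h1 := (hV₀ _ hBV inter_subset_right).1.trans ((measure_mono inter_subset_left).trans hBt)
    rw [mul_comm, ← ENNReal.le_div_iff_mul_le (Or.inl (by simpa using ha))
      (Or.inl ENNReal.ofReal_ne_top), ← ENNReal.ofReal_div_of_pos ha] at h1
    refine h1.trans (ENNReal.ofReal_le_ofReal ?_)
    have hai : 0 < a⁻¹ := inv_pos.2 ha
    calc t ^ d / a = a⁻¹ * t ^ d := by rw [div_eq_inv_mul]
      _ ≤ (1 + a⁻¹) ^ m * t ^ m := by
          refine mul_le_mul ?_ (pow_le_pow_of_le_one ht.le ht1 hmd) (by positivity) (by positivity)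
          exact (le_add_of_nonneg_left zero_le_one).trans
            (le_self_pow₀ (le_add_of_nonneg_right hai.le) hm)
      _ = _ := (mul_pow _ _ _).symm
  have hAU : U ∩ f ⁻¹' B ⊆ U₀ := fun p hp => (hU hp.1).1.1
  calc vol (U ∩ f ⁻¹' B) ≤ ENNReal.ofReal b * volume (e '' (U ∩ f ⁻¹' B)) :=
        (hU₀ _ (hUo.measurableSet.inter (hf.continuous.measurable hB)) hAU).2
    _ ≤ ENNReal.ofReal b * ENNReal.ofReal (C * ((1 + a⁻¹) * t)) := by
        gcongr
        refine (measure_mono ?_).trans (hC _ (by positivity) _ hB'm hB')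
        rintro _ ⟨p, hp, rfl⟩
        refine ⟨(hU hp.1).2, ?_⟩
        rw [mem_preimage, Function.comp_apply, Function.comp_apply, e.left_inv (hU₀s (hAU hp))]
        exact ⟨f p, ⟨hp.2, (hU hp.1).1.2⟩, rfl⟩
    _ = ENNReal.ofReal (b * (C * (1 + a⁻¹)) * t) := by
        rw [← ENNReal.ofReal_mul hb.le]; ring_nf

/-- The volume of `f ⁻¹' B` is at most a constant times `vol (B) ^ (1 / d)`, for `vol B ≤ 1`. -/
theorem exists_volume_preimage_le {X : Type*} [TopologicalSpace X] [CompactSpace X]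
    [ConnectedSpace X] [ChartedSpace ℂ X] [IsManifold 𝓘(ℂ) ω X]
    [MeasurableSpace X] [BorelSpace X] {vol : Measure X} (hvol : IsSmoothVolume vol)
    {f : X → X} (hf : MDifferentiable 𝓘(ℂ) 𝓘(ℂ) f)
    {d : ℕ} (hd : d ≠ 0) (hdeg : HasTopologicalDegree f d) :
    ∃ K : ℝ, ∀ t : ℝ, 0 < t → t ≤ 1 → ∀ B : Set X, MeasurableSet B →
      vol B ≤ ENNReal.ofReal (t ^ d) → vol (f ⁻¹' B) ≤ ENNReal.ofReal (K * t) := by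
  have key : ∃ K : ℝ, 0 ≤ K ∧ ∀ t : ℝ, 0 < t → t ≤ 1 → ∀ B : Set X, MeasurableSet B →
      vol B ≤ ENNReal.ofReal (t ^ d) → vol (univ ∩ f ⁻¹' B) ≤ ENNReal.ofReal (K * t) := by
    refine isCompact_univ.induction_on (p := fun s => ∃ K : ℝ, 0 ≤ K ∧ ∀ t : ℝ, 0 < t → t ≤ 1 →
      ∀ B : Set X, MeasurableSet B → vol B ≤ ENNReal.ofReal (t ^ d) →
        vol (s ∩ f ⁻¹' B) ≤ ENNReal.ofReal (K * t)) ⟨0, le_rfl, by simp⟩ ?_ ?_ ?_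
    · rintro s s' hss' ⟨K, hK, h⟩
      exact ⟨K, hK, fun t ht ht1 B hB hBt =>
        (measure_mono (inter_subset_inter_left _ hss')).trans (h t ht ht1 B hB hBt)⟩
    · rintro s s' ⟨K, hK, h⟩ ⟨K', hK', h'⟩
      refine ⟨K + K', add_nonneg hK hK', fun t ht ht1 B hB hBt => ?_⟩
      rw [union_inter_distrib_right, add_mul,
        ENNReal.ofReal_add (mul_nonneg hK ht.le) (mul_nonneg hK' ht.le)]
      exact (measure_union_le _ _).trans (add_le_add (h t ht ht1 B hB hBt) (h' t ht ht1 B hB hBt))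
    · intro x _
      obtain ⟨U, hU, K, h⟩ := exists_nhds_volume_preimage_le hvol hf hd hdeg x
      exact ⟨U, mem_nhdsWithin_of_mem_nhds hU, max K 0, le_max_right _ _,
        fun t ht ht1 B hB hBt => (h t ht ht1 B hB hBt).trans
          (ENNReal.ofReal_le_ofReal (mul_le_mul_of_nonneg_right (le_max_left _ _) ht.le))⟩
  obtain ⟨K, -, h⟩ := key
  exact ⟨K, by simpa only [univ_inter] using h⟩

/-- The image of a set of volume `v` has outer volume at least `c * v ^ d`. The normalization
`c ≤ 1` is what makes the estimate iterate. -/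
theorem exists_mul_pow_le_real_image {X : Type*} [TopologicalSpace X] [CompactSpace X]
    [ConnectedSpace X] [ChartedSpace ℂ X] [IsManifold 𝓘(ℂ) ω X]
    [MeasurableSpace X] [BorelSpace X] {vol : Measure X} (hvol : IsSmoothVolume vol)
    {f : X → X} (hf : MDifferentiable 𝓘(ℂ) 𝓘(ℂ) f)
    {d : ℕ} (hd : d ≠ 0) (hdeg : HasTopologicalDegree f d) :
    ∃ c : ℝ, 0 < c ∧ c ≤ 1 ∧ ∀ A : Set X, c * vol.real A ^ d ≤ vol.real (f '' A) := by
  have := hvol.isFiniteMeasure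
  obtain ⟨K, hK⟩ := exists_volume_preimage_le hvol hf hd hdeg
  -- `M` bounds both `K` and `vol A`, so that `t = vol A / (2 * M)` is at most `1`. If the image had
  -- volume less than `t ^ d`, then `A` would have volume at most `M * t = vol A / 2`.
  set M : ℝ := 1 + |K| + vol.real univ with hM
  have hM1 : 1 ≤ M := by
    have := abs_nonneg K
    have := measureReal_nonneg (μ := vol) (s := univ)
    linarith
  have hM0 : 0 < M := one_pos.trans_le hM1
  refine ⟨((2 * M)⁻¹) ^ d, by positivity,
    pow_le_one₀ (by positivity) (inv_le_one_of_one_le₀ (by linarith)), fun A => ?_⟩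
  rw [← mul_pow]
  rcases (measureReal_nonneg (μ := vol) (s := A)).eq_or_lt with h0 | h0
  · rw [← h0, mul_zero, zero_pow hd]; exact measureReal_nonneg
  by_contra! hlt
  set t := (2 * M)⁻¹ * vol.real A with ht
  have ht0 : 0 < t := by positivity
  have hAM : vol.real A ≤ M := by
    have := measureReal_mono (μ := vol) (subset_univ A)
    have := abs_nonneg K
    linarith
  have htM : M * t = vol.real A / 2 := by rw [ht]; field_simp
  have ht1 : t ≤ 1 := by
    by_contra! h
    nlinarith
  have h1 := hK t ht0 ht1 (toMeasurable vol (f '' A)) (measurableSet_toMeasurable _ _) (by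
    rw [measure_toMeasurable, ← ofReal_measureReal]
    exact ENNReal.ofReal_le_ofReal hlt.le)
  have h2 : vol.real A ≤ M * t := by
    refine ENNReal.toReal_le_of_le_ofReal (by positivity) (le_trans ?_ (h1.trans
      (ENNReal.ofReal_le_ofReal ?_)))
    · exact measure_mono ((subset_preimage_image f A).trans
        (preimage_mono (subset_toMeasurable _ _)))
    · refine mul_le_mul_of_nonneg_right ?_ ht0.le
      have := le_abs_self K
      have := measureReal_nonneg (μ := vol) (s := univ)
      linarith
  linarith

theorem mainTheorem9 {X : Type*} [TopologicalSpace X] [T2Space X] [CompactSpace X]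
    [ConnectedSpace X] [ChartedSpace ℂ X] [IsManifold 𝓘(ℂ) ω X]
    [MeasurableSpace X] [BorelSpace X]
    (vol : Measure X) (hvol : IsSmoothVolume vol)
    (f : X → X) (hf : MDifferentiable 𝓘(ℂ) 𝓘(ℂ) f)
    (lam : ℕ) (hlam : 2 ≤ lam) (hdeg : HasTopologicalDegree f lam) :
    ∃ C : ℝ, 0 < C ∧ ∀ (j : ℕ) (Ω : Set X), MeasurableSet Ω → 0 < vol Ω →
      Real.exp (-(C / vol.real Ω) * (lam : ℝ) ^ j) ≤ vol.real (f^[j] '' Ω) := by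
  have := hvol.isFiniteMeasure
  obtain ⟨c, hc, hc1, h⟩ := exists_mul_pow_le_real_image hvol hf (by omega) hdeg
  refine ⟨c⁻¹, inv_pos.2 hc, fun j Ω _ hΩ => ?_⟩
  have hv : 0 < vol.real Ω := ENNReal.toReal_pos hΩ.ne' (measure_ne_top _ _)
  -- Carrying the factor `c` on the right as well makes the induction close.
  have hiter : (c * vol.real Ω) ^ lam ^ j ≤ c * vol.real (f^[j] '' Ω) := by
    induction j with
    | zero => simp
    | succ j ih =>
      calc (c * vol.real Ω) ^ lam ^ (j + 1) = ((c * vol.real Ω) ^ lam ^ j) ^ lam := by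
            rw [pow_succ, pow_mul]
        _ ≤ (c * vol.real (f^[j] '' Ω)) ^ lam := pow_le_pow_left₀ (by positivity) ih _
        _ = c ^ lam * vol.real (f^[j] '' Ω) ^ lam := mul_pow _ _ _
        _ ≤ c ^ 2 * vol.real (f^[j] '' Ω) ^ lam :=
            mul_le_mul_of_nonneg_right (pow_le_pow_of_le_one hc.le hc1 hlam) (by positivity)
        _ = c * (c * vol.real (f^[j] '' Ω) ^ lam) := by ring
        _ ≤ c * vol.real (f^[j + 1] '' Ω) := by
            rw [Function.iterate_succ', image_comp]
            exact mul_le_mul_of_nonneg_left (h _) hc.le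
  calc Real.exp (-(c⁻¹ / vol.real Ω) * (lam : ℝ) ^ j)
      = Real.exp (-(c * vol.real Ω)⁻¹) ^ lam ^ j := by
        rw [← Real.exp_nat_mul, Nat.cast_pow]
        congr 1
        rw [mul_inv, div_eq_mul_inv]; ring
    _ ≤ (c * vol.real Ω) ^ lam ^ j := by
        refine pow_le_pow_left₀ (Real.exp_pos _).le ?_ _
        have hpos : 0 < c * vol.real Ω := mul_pos hc hv
        rw [Real.exp_neg]
        refine inv_le_of_inv_le₀ hpos ?_
        linarith [Real.add_one_le_exp (c * vol.real Ω)⁻¹]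
    _ ≤ c * vol.real (f^[j] '' Ω) := hiter
    _ ≤ vol.real (f^[j] '' Ω) := mul_le_of_le_one_left measureReal_nonneg hc1
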